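/- Let $L$ be a non-empty distributive lattice and let $L^*$ be the set of all lattice homomorphisms $x^*:L\to[-1,1]$. A function $f:L^*\to\mathbb R$ is positively homogeneous if $f(\lambda x^*)=\lambda f(x^*)$ whenever $x^*\in L^*$, $\lambda\ge 0$ and $\lambda x^*\in L^*$. For such $f$ put $$\|f\|=\sup\Big\{\sum_{i=1}^m|f(x_i^*)|:\ m\in\mathbb N,\ x_1^*,\dots,x_m^*\in L^*,\ \sup_{x\in L}\sum_{i=1}^m|x_i^*(x)|\le 1\Big\}.$$ For $x\in L$ let $\delta_x:L^*\to\mathbb R$, $\delta_x(x^*)=x^*(x)$. The free Banach lattice $\mathrm{FBL}\langle L\rangle$ is the Banach lattice generated by $\{\delta_x:x\in L\}$ in the space of all positively homogeneous functions $f:L^*\to\mathbb R$ with $\|f\|<\infty$, with this norm and the pointwise order, that is, the norm closure of the vector sublattice generated by the $\delta_x$. Let $\mathrm{FVL}\langle L\rangle$ be the vector sublattice of $\mathrm{FBL}\langle L\rangle$ generated by $\{\delta_x:x\in L\}$. It is called order dense in $\mathrm{FBL}\langle L\rangle$ if for every $f\in\mathrm{FBL}\langle L\rangle$ with $f>0$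 there is $g\in\mathrm{FVL}\langle L\rangle$ with $0<g\le f$. (1) If $L$ is countably order bounded, i.e. for every countable $A\subseteq L$ there are $a,b\in L$ with $a\le x\le b$ for all $x\in A$, then $\mathrm{FVL}\langle L\rangle$ is order dense in $\mathrm{FBL}\langle L\rangle$. (2) If $L$ is totally ordered and $\mathrm{FVL}\langle L\rangle$ is order dense in $\mathrm{FBL}\langle L\rangle$, then $L$ is countably order bounded. -/

import Mathlib

noncomputable section

universe u v

/-- A subset `A` of a lattice is *order bounded* if it lies in some interval `[a, b]`; the lattice
is *countably order bounded* if each of its countable subsets is order bounded. -/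
def CountablyOrderBounded (L : Type u) [Lattice L] : Prop :=
  ∀ A : Set L, A.Countable → ∃ a b : L, ∀ x ∈ A, a ≤ x ∧ x ≤ b

section VectorLattice

variable {E : Type v} [AddCommGroup E] [Module ℝ E] [Lattice E]

/-- The vector sublattice of `E` generated by `A`: the smallest linear subspace which contains `A`
and is closed under `⊔` and `⊓`. -/
def vectorLat (A : Set E) : Submodule ℝ E :=
  sInf {S : Submodule ℝ E | A ⊆ S ∧ SupClosed (S : Set E) ∧ InfClosed (S : Set E)}

/-- A vector sublattice `S` of `E` is *order dense* if below every `f > 0` of `E`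
there is some `g > 0` of `S`. -/
def IsOrderDense (S : Submodule ℝ E) : Prop :=
  ∀ f : E, 0 < f → ∃ g ∈ S, 0 < g ∧ g ≤ f

theorem subset_vectorLat (A : Set E) : A ⊆ vectorLat A := by
  intro x hx
  simp only [vectorLat, SetLike.mem_coe, Submodule.mem_sInf]
  exact fun S hS => hS.1 hx

theorem supClosed_vectorLat (A : Set E) : SupClosed (vectorLat A : Set E) := by
  intro x hx y hy
  simp only [vectorLat, SetLike.mem_coe, Submodule.mem_sInf] at hx hy ⊢
  exact fun S hS => hS.2.1 (hx S hS) (hy S hS)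

theorem infClosed_vectorLat (A : Set E) : InfClosed (vectorLat A : Set E) := by
  intro x hx y hy
  simp only [vectorLat, SetLike.mem_coe, Submodule.mem_sInf] at hx hy ⊢
  exact fun S hS => hS.2.2 (hx S hS) (hy S hS)

end VectorLattice

/-- `L^*`: the set of all lattice homomorphisms `L → [-1, 1]`. -/
abbrev LStar (L : Type u) [Lattice L] : Type u :=
  LatticeHom L (Set.Icc (-1 : ℝ) 1)

/-- `f : L^* → ℝ` is positively homogeneous: `f (r • x) = r * f x` whenever `0 ≤ r` and the
pointwise multiple `r • x` is again an element `y` of `L^*`. -/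
def PosHom {L : Type u} [Lattice L] (f : LStar L → ℝ) : Prop :=
  ∀ (x y : LStar L) (r : ℝ), 0 ≤ r → (∀ a : L, (y a : ℝ) = r * (x a : ℝ)) → f y = r * f x

/-- The sums `∑ i, |f (x i)|` over all finite families `x` in `L^*` with
`∑ i, |x i a| ≤ 1` for every `a : L`. -/
def testSums {L : Type u} [Lattice L] (f : LStar L → ℝ) : Set ℝ :=
  {s | ∃ (m : ℕ) (x : Fin m → LStar L),
    (∀ a : L, ∑ i, |(x i a : ℝ)| ≤ 1) ∧ s = ∑ i, |f (x i)|}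

section Ambient

variable {L : Type u} [Lattice L]

theorem testSums_nonempty (f : LStar L → ℝ) : (testSums f).Nonempty :=
  ⟨0, 0, Fin.elim0, by simp, by simp⟩

theorem abs_mem_testSums (f : LStar L → ℝ) (x : LStar L) : |f x| ∈ testSums f := by
  refine ⟨1, fun _ => x, fun a => ?_, by simp⟩
  have h : |(x a : ℝ)| ≤ 1 := abs_le.2 (x a).2
  simpa using h

theorem testSums_dominated {f g h : LStar L → ℝ} {B C : ℝ}
    (hfg : ∀ x, |h x| ≤ |f x| + |g x|)
    (hf : ∀ s ∈ testSums f, s ≤ B) (hg : ∀ s ∈ testSums g, s ≤ C) :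
    ∀ s ∈ testSums h, s ≤ B + C := by
  rintro s ⟨m, x, hx, rfl⟩
  calc ∑ i, |h (x i)| ≤ ∑ i, (|f (x i)| + |g (x i)|) := Finset.sum_le_sum fun i _ => hfg _
    _ = ∑ i, |f (x i)| + ∑ i, |g (x i)| := Finset.sum_add_distrib
    _ ≤ B + C := add_le_add (hf _ ⟨m, x, hx, rfl⟩) (hg _ ⟨m, x, hx, rfl⟩)

theorem testSums_smul (c : ℝ) (f : LStar L → ℝ) :
    testSums (c • f) = (fun s => |c| * s) '' testSums f := by
  ext s
  constructor
  · rintro ⟨m, x, hx, rfl⟩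
    exact ⟨_, ⟨m, x, hx, rfl⟩, by simp [Finset.mul_sum, abs_mul]⟩
  · rintro ⟨_, ⟨m, x, hx, rfl⟩, rfl⟩
    exact ⟨m, x, hx, by simp [Finset.mul_sum, abs_mul]⟩

theorem bddAbove_of_dominated {f g h : LStar L → ℝ}
    (hfg : ∀ x, |h x| ≤ |f x| + |g x|)
    (hf : BddAbove (testSums f)) (hg : BddAbove (testSums g)) : BddAbove (testSums h) := by
  obtain ⟨B, hB⟩ := hf
  obtain ⟨C, hC⟩ := hg
  exact ⟨B + C, testSums_dominated hfg hB hC⟩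

variable (L)

/-- The positively homogeneous functions `f : L^* → ℝ` with `‖f‖ < ∞`, as a linear subspace. -/
def ambientSubmodule : Submodule ℝ (LStar L → ℝ) where
  carrier := {f | PosHom f ∧ BddAbove (testSums f)}
  add_mem' := by
    rintro f g ⟨hf, hf'⟩ ⟨hg, hg'⟩
    refine ⟨fun x y r hr h => ?_, bddAbove_of_dominated (fun x => abs_add_le _ _) hf' hg'⟩
    simp only [Pi.add_apply, hf x y r hr h, hg x y r hr h, mul_add]
  zero_mem' := by
    refine ⟨fun x y r hr h => by simp, ⟨0, ?_⟩⟩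
    rintro s ⟨m, x, hx, rfl⟩
    simp
  smul_mem' := by
    rintro c f ⟨hf, B, hB⟩
    refine ⟨fun x y r hr h => ?_, ⟨|c| * B, ?_⟩⟩
    · simp only [Pi.smul_apply, smul_eq_mul, hf x y r hr h]
      ring
    · rw [testSums_smul]
      rintro _ ⟨s, hs, rfl⟩
      exact mul_le_mul_of_nonneg_left (hB hs) (abs_nonneg c)

/-- The type of positively homogeneous functions on `L^*` with finite norm. -/
def Ambient : Type u := ↥(ambientSubmodule L)

namespace Ambient

instance : AddCommGroup (Ambient L) := inferInstanceAs (AddCommGroup ↥(ambientSubmodule L))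

instance : Module ℝ (Ambient L) := inferInstanceAs (Module ℝ ↥(ambientSubmodule L))

/-- The pointwise order and lattice operations. -/
instance : Lattice (Ambient L) :=
  Subtype.lattice (P := fun f => f ∈ ambientSubmodule L)
    (by
      rintro f g ⟨hf, hf'⟩ ⟨hg, hg'⟩
      refine ⟨fun x y r hr h => ?_, bddAbove_of_dominated (fun x => ?_) hf' hg'⟩
      · simp only [Pi.sup_apply, hf x y r hr h, hg x y r hr h]
        exact (mul_max_of_nonneg _ _ hr).symm
      · exact (abs_max_le_max_abs_abs (a := f x) (b := g x)).trans
          (max_le_add_of_nonneg (abs_nonneg _) (abs_nonneg _)))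
    (by
      rintro f g ⟨hf, hf'⟩ ⟨hg, hg'⟩
      refine ⟨fun x y r hr h => ?_, bddAbove_of_dominated (fun x => ?_) hf' hg'⟩
      · simp only [Pi.inf_apply, hf x y r hr h, hg x y r hr h]
        exact (mul_min_of_nonneg _ _ hr).symm
      · exact (abs_min_le_max_abs_abs (a := f x) (b := g x)).trans
          (max_le_add_of_nonneg (abs_nonneg _) (abs_nonneg _)))

variable {L}

instance : FunLike (Ambient L) (LStar L) ℝ where
  coe f := f.1
  coe_injective _ _ h := Subtype.ext h

/-- A positively homogeneous function of finite norm, as an element of `Ambient L`. -/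
def mk (f : LStar L → ℝ) (hf : PosHom f) (hb : BddAbove (testSums f)) : Ambient L :=
  ⟨f, hf, hb⟩

@[simp] theorem mk_apply (f : LStar L → ℝ) (hf : PosHom f) (hb : BddAbove (testSums f))
    (x : LStar L) : mk f hf hb x = f x := rfl

@[ext] theorem ext {f g : Ambient L} (h : ∀ x, f x = g x) : f = g :=
  DFunLike.ext f g h

theorem posHom (f : Ambient L) : PosHom (f : LStar L → ℝ) := f.2.1

theorem bddAbove (f : Ambient L) : BddAbove (testSums (f : LStar L → ℝ)) := f.2.2

@[simp] theorem zero_apply (x : LStar L) : (0 : Ambient L) x = 0 := rfl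
@[simp] theorem add_apply (f g : Ambient L) (x : LStar L) : (f + g) x = f x + g x := rfl
@[simp] theorem neg_apply (f : Ambient L) (x : LStar L) : (-f) x = -f x := rfl
@[simp] theorem sub_apply (f g : Ambient L) (x : LStar L) : (f - g) x = f x - g x := rfl
@[simp] theorem smul_apply (c : ℝ) (f : Ambient L) (x : LStar L) : (c • f) x = c * f x := rfl
@[simp] theorem sup_apply (f g : Ambient L) (x : LStar L) : (f ⊔ g) x = f x ⊔ g x := rfl
@[simp] theorem inf_apply (f g : Ambient L) (x : LStar L) : (f ⊓ g) x = f x ⊓ g x := rfl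
@[simp] theorem abs_apply (f : Ambient L) (x : LStar L) : |f| x = |f x| := rfl
theorem le_def (f g : Ambient L) : f ≤ g ↔ ∀ x, f x ≤ g x := Iff.rfl

instance : IsOrderedAddMonoid (Ambient L) where
  add_le_add_left _ _ h k := fun x => add_le_add_left (h x) (k x)

/-- `‖f‖ = sup ∑ i, |f (x i)|`, over all finite families `x` in `L^*` with
`sup_a ∑ i, |x i a| ≤ 1`. -/
instance : Norm (Ambient L) := ⟨fun f => sSup (testSums (f : LStar L → ℝ))⟩

theorem norm_def (f : Ambient L) : ‖f‖ = sSup (testSums (f : LStar L → ℝ)) := rfl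

theorem le_norm_of_mem (f : Ambient L) {s : ℝ} (hs : s ∈ testSums (f : LStar L → ℝ)) :
    s ≤ ‖f‖ := le_csSup f.bddAbove hs

theorem norm_le_of (f : Ambient L) {B : ℝ} (h : ∀ s ∈ testSums (f : LStar L → ℝ), s ≤ B) :
    ‖f‖ ≤ B := csSup_le (testSums_nonempty _) h

theorem abs_apply_le_norm (f : Ambient L) (x : LStar L) : |f x| ≤ ‖f‖ :=
  f.le_norm_of_mem (abs_mem_testSums _ x)

theorem normCore : NormedSpace.Core ℝ (Ambient L) where
  norm_nonneg f := by
    have h0 : (0 : ℝ) ∈ testSums (f : LStar L → ℝ) := ⟨0, Fin.elim0, by simp, by simp⟩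
    exact f.le_norm_of_mem h0
  norm_smul c f := by
    change sSup (testSums (c • (f : LStar L → ℝ))) = |c| * sSup (testSums (f : LStar L → ℝ))
    rw [testSums_smul, ← smul_eq_mul, ← Real.sSup_smul_of_nonneg (abs_nonneg c)]
    rfl
  norm_triangle f g :=
    norm_le_of _ (testSums_dominated (fun _ => abs_add_le _ _)
      (fun _ => f.le_norm_of_mem) (fun _ => g.le_norm_of_mem))
  norm_eq_zero_iff f := by
    constructor
    · intro h
      ext x
      have := f.abs_apply_le_norm x
      rw [h] at this
      simpa using this
    · rintro rfl
      refine le_antisymm (norm_le_of _ ?_) ((0 : Ambient L).le_norm_of_mem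
        ⟨0, Fin.elim0, by simp, by simp⟩)
      rintro s ⟨m, x, hx, rfl⟩
      simp

instance : NormedAddCommGroup (Ambient L) := NormedAddCommGroup.ofCore normCore

instance : NormedSpace ℝ (Ambient L) := NormedSpace.ofCore normCore

instance : HasSolidNorm (Ambient L) where
  solid f g h := by
    refine norm_le_of _ ?_
    rintro s ⟨m, x, hx, rfl⟩
    exact (Finset.sum_le_sum fun i _ => h (x i)).trans (g.le_norm_of_mem ⟨m, x, hx, rfl⟩)

instance : IsOrderedModule ℝ (Ambient L) where
  smul_le_smul_of_nonneg_left _ hc _ _ h := fun x => mul_le_mul_of_nonneg_left (h x) hc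
  smul_le_smul_of_nonneg_right _ hf _ _ h := fun x => mul_le_mul_of_nonneg_right h (hf x)

instance : CompleteSpace (Ambient L) := by
  refine Metric.complete_of_cauchySeq_tendsto fun u hu => ?_
  have hpt : ∀ x, ∃ l : ℝ, Filter.Tendsto (fun n => u n x) Filter.atTop (nhds l) := fun x => by
    refine cauchySeq_tendsto_of_complete (Metric.cauchySeq_iff'.2 fun ε hε => ?_)
    obtain ⟨N, hN⟩ := Metric.cauchySeq_iff'.1 hu ε hε
    refine ⟨N, fun n hn => lt_of_le_of_lt ?_ (hN n hn)⟩
    rw [Real.dist_eq, dist_eq_norm (u n)]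
    exact (u n - u N).abs_apply_le_norm x
  choose F hF using hpt
  have key : ∀ ε > 0, ∃ N, ∀ n ≥ N, ∀ s ∈ testSums (fun x => u n x - F x), s ≤ ε := by
    intro ε hε
    obtain ⟨N, hN⟩ := Metric.cauchySeq_iff.1 hu ε hε
    refine ⟨N, fun n hn => ?_⟩
    rintro s ⟨m, x, hx, rfl⟩
    have ht : Filter.Tendsto (fun k => ∑ i, |u n (x i) - u k (x i)|) Filter.atTop
        (nhds (∑ i, |u n (x i) - F (x i)|)) :=
      tendsto_finsetSum _ fun i _ => (tendsto_const_nhds.sub (hF (x i))).abs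
    refine le_of_tendsto ht (Filter.eventually_atTop.2 ⟨N, fun k hk => ?_⟩)
    refine le_trans ?_ (hN n hn k hk).le
    rw [dist_eq_norm]
    exact (u n - u k).le_norm_of_mem ⟨m, x, hx, rfl⟩
  have hmem : PosHom F ∧ BddAbove (testSums F) := by
    refine ⟨fun x y r hr h => ?_, ?_⟩
    · refine tendsto_nhds_unique (hF y) ?_
      have : (fun n => u n y) = fun n => r * u n x := funext fun n => (u n).posHom x y r hr h
      rw [this]
      exact (hF x).const_mul r
    · obtain ⟨N, hN⟩ := key 1 one_pos
      exact bddAbove_of_dominated (f := (u N : LStar L → ℝ)) (g := fun x => u N x - F x)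
        (fun x => by
          have := abs_sub (u N x) (u N x - F x)
          simpa using this) (u N).bddAbove ⟨1, hN N le_rfl⟩
  refine ⟨mk F hmem.1 hmem.2, Metric.tendsto_atTop.2 fun ε hε => ?_⟩
  obtain ⟨N, hN⟩ := key (ε / 2) (half_pos hε)
  refine ⟨N, fun n hn => lt_of_le_of_lt ?_ (half_lt_self hε)⟩
  rw [dist_eq_norm]
  exact norm_le_of _ (hN n hn)

/-- The evaluation `δ_a : x ↦ x a`. -/
def eval (a : L) : Ambient L :=
  mk (fun x => (x a : ℝ)) (fun _ _ _ _ h => h a) ⟨1, by rintro s ⟨m, x, hx, rfl⟩; exact hx a⟩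

@[simp] theorem eval_apply (a : L) (x : LStar L) : eval a x = (x a : ℝ) := rfl

end Ambient

end Ambient

section FBL

variable (L : Type u) [Lattice L]

/-- The closed vector sublattice generated by the evaluations `δ_a`, `a : L`: the norm closure of
the vector sublattice that they generate. -/
def fblSubmodule : Submodule ℝ (Ambient L) :=
  (vectorLat (Set.range (Ambient.eval (L := L)))).topologicalClosure

/-- The free Banach lattice `FBL⟨L⟩`: the Banach lattice generated by the evaluations `δ_a`
among the positively homogeneous functions on `L^*` of finite norm. -/
def FBL : Type u := ↥(fblSubmodule L)

namespace FBL

instance : NormedAddCommGroup (FBL L) := inferInstanceAs (NormedAddCommGroup ↥(fblSubmodule L))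

instance : NormedSpace ℝ (FBL L) := inferInstanceAs (NormedSpace ℝ ↥(fblSubmodule L))

/-- The pointwise order and lattice operations. -/
instance : Lattice (FBL L) :=
  Subtype.lattice (P := fun f => f ∈ fblSubmodule L)
    (fun _ _ hf hg => map_mem_closure₂ continuous_sup hf hg
      (fun _ ha _ hb => supClosed_vectorLat _ ha hb))
    (fun _ _ hf hg => map_mem_closure₂ continuous_inf hf hg
      (fun _ ha _ hb => infClosed_vectorLat _ ha hb))

instance : IsOrderedAddMonoid (FBL L) where
  add_le_add_left _ _ h k := add_le_add_left (α := Ambient L) h k.1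

instance : HasSolidNorm (FBL L) where
  solid _ _ h := HasSolidNorm.solid (α := Ambient L) h

instance : IsOrderedModule ℝ (FBL L) where
  smul_le_smul_of_nonneg_left _ hc _ _ h := smul_le_smul_of_nonneg_left (β := Ambient L) h hc
  smul_le_smul_of_nonneg_right _ hf _ _ h := smul_le_smul_of_nonneg_right (β := Ambient L) h hf

instance : CompleteSpace (FBL L) :=
  (Submodule.isClosed_topologicalClosure (vectorLat _)).completeSpace_coe

variable {L}

instance : FunLike (FBL L) (LStar L) ℝ where
  coe f := (show Ambient L from f.1)
  coe_injective _ _ h := Subtype.ext (DFunLike.coe_injective h)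

@[ext] theorem ext {f g : FBL L} (h : ∀ x, f x = g x) : f = g := DFunLike.ext f g h

@[simp] theorem zero_apply (x : LStar L) : (0 : FBL L) x = 0 := rfl
@[simp] theorem add_apply (f g : FBL L) (x : LStar L) : (f + g) x = f x + g x := rfl
@[simp] theorem neg_apply (f : FBL L) (x : LStar L) : (-f) x = -f x := rfl
@[simp] theorem sub_apply (f g : FBL L) (x : LStar L) : (f - g) x = f x - g x := rfl
@[simp] theorem smul_apply (c : ℝ) (f : FBL L) (x : LStar L) : (c • f) x = c * f x := rfl
@[simp] theorem sup_apply (f g : FBL L) (x : LStar L) : (f ⊔ g) x = f x ⊔ g x := rfl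
@[simp] theorem inf_apply (f g : FBL L) (x : LStar L) : (f ⊓ g) x = f x ⊓ g x := rfl
theorem le_def (f g : FBL L) : f ≤ g ↔ ∀ x, f x ≤ g x := Iff.rfl
theorem norm_def (f : FBL L) : ‖f‖ = sSup (testSums (f : LStar L → ℝ)) := rfl

/-- The canonical lattice homomorphism `δ_L : L → FBL⟨L⟩`, `a ↦ δ_a`. -/
def δ : LatticeHom L (FBL L) where
  toFun a := ⟨Ambient.eval a, subset_closure (subset_vectorLat _ ⟨a, rfl⟩)⟩
  map_sup' a b := Subtype.ext (Ambient.ext fun x => congrArg Subtype.val (map_sup x a b))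
  map_inf' a b := Subtype.ext (Ambient.ext fun x => congrArg Subtype.val (map_inf x a b))

@[simp] theorem δ_apply (a : L) (x : LStar L) : δ a x = (x a : ℝ) := rfl

end FBL

/-- `FVL⟨L⟩`: the vector sublattice of `FBL⟨L⟩` generated by the elements `δ_a`, `a : L`. -/
def FVL : Submodule ℝ (FBL L) := vectorLat (Set.range (FBL.δ (L := L)))

end FBL

end

/-!
Every element of `FVL⟨L⟩` is built from finitely many evaluations, hence its value at `x` only
depends on the restriction of `x` to some interval `[p, q]` of `L`
(`exists_dependsOnVals_Icc_of_mem_FVL`).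

If `L` is countably order bounded, take `f > 0` in `FBL⟨L⟩` as the limit of a sequence in
`FVL⟨L⟩`. The countably many intervals involved lie in one interval `[a, b]`, so `f` and all its
approximants depend on values in `[a, b]` only. With `M = |δ_a| ⊔ |δ_b|`, the restriction of `x` to
`[a, b]` is the number `M(x)` times the restriction of another element of `L^*`. So positive homogeneity
upgrades an estimate `|v - f| ≤ ε` to `|v - f| ≤ ε M`
(`abs_le_mul_of_dependsOnVals_Icc`). Thus `g = (v - ε M)⁺` satisfies `0 ≤ g ≤ f`, and `g ≠ 0` when
`ε` is small.

If `L` is a chain with an unbounded countable subset `{s 0, s 1, …}`, then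
`f = (|δ_c| - ∑ₖ 2^{-k-2} |δ_{s k}|)⁺` is positive at the constant homomorphism `1`. Suppose
`0 < g ≤ f` with `g ∈ FVL⟨L⟩` depending on `[p, q] ∋ c` only, and `g x > 0`. Replacing `x` by `r x`
on `[p, q]`, by `1` above `q` and by `-1` below `p`, one gets a homomorphism at which `g` takes the
value `r · g x > 0`. But some `s k` lies outside `[p, q]`, so that `f` vanishes there as soon as
`r ≤ 2^{-k-2}`.
-/

universe w

/-! ### Elements of the free vector lattice depend on values in an interval -/

theorem vectorLat_induction {E : Type w} [AddCommGroup E] [Module ℝ E] [Lattice E] {A : Set E}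
    {P : E → Prop} (mem : ∀ a ∈ A, P a) (zero : P 0)
    (add : ∀ a b, P a → P b → P (a + b)) (smul : ∀ (c : ℝ) a, P a → P (c • a))
    (sup : ∀ a b, P a → P b → P (a ⊔ b)) (inf : ∀ a b, P a → P b → P (a ⊓ b))
    {u : E} (hu : u ∈ vectorLat A) : P u := by
  let S : Submodule ℝ E :=
    { carrier := {u | P u}
      add_mem' := fun {a b} => add a b
      zero_mem' := zero
      smul_mem' := smul }
  have hS : vectorLat A ≤ S :=
    sInf_le ⟨mem, fun a ha b hb => sup a b ha hb, fun a ha b hb => inf a b ha hb⟩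
  exact hS hu

variable {L : Type w} [Lattice L]

/-- The value of `h` at `x : L^*` only depends on the restriction of `x` to `A ⊆ L`. -/
def DependsOnVals (h : LStar L → ℝ) (A : Set L) : Prop :=
  ∀ x y : LStar L, (∀ a ∈ A, x a = y a) → h x = h y

theorem DependsOnVals.mono {h : LStar L → ℝ} {A B : Set L} (hA : DependsOnVals h A)
    (hAB : A ⊆ B) : DependsOnVals h B :=
  fun x y hxy => hA x y fun a ha => hxy a (hAB ha)

theorem dependsOnVals_Icc_inf_sup {h k : LStar L → ℝ} {p q p' q' : L}
    (hh : DependsOnVals h (Set.Icc p q)) (hk : DependsOnVals k (Set.Icc p' q')) :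
    DependsOnVals h (Set.Icc (p ⊓ p') (q ⊔ q')) ∧
      DependsOnVals k (Set.Icc (p ⊓ p') (q ⊔ q')) :=
  ⟨hh.mono (Set.Icc_subset_Icc inf_le_left le_sup_left),
    hk.mono (Set.Icc_subset_Icc inf_le_right le_sup_right)⟩

theorem exists_dependsOnVals_Icc_of_mem_FVL [Nonempty L] {v : FBL L} (hv : v ∈ FVL L) :
    ∃ p q : L, DependsOnVals v (Set.Icc p q) := by
  refine vectorLat_induction (P := fun v : FBL L => ∃ p q : L, DependsOnVals v (Set.Icc p q))
    ?_ ?_ ?_ ?_ ?_ ?_ hv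
  · rintro _ ⟨a, rfl⟩
    exact ⟨a, a, fun x y hxy => by simp [hxy a (by simp)]⟩
  · obtain ⟨a⟩ := ‹Nonempty L›
    exact ⟨a, a, fun x y _ => rfl⟩
  · rintro u v ⟨p, q, hu⟩ ⟨p', q', hv⟩
    obtain ⟨hu, hv⟩ := dependsOnVals_Icc_inf_sup hu hv
    exact ⟨p ⊓ p', q ⊔ q', fun x y hxy => by simp [hu x y hxy, hv x y hxy]⟩
  · rintro c u ⟨p, q, hu⟩
    exact ⟨p, q, fun x y hxy => by simp [hu x y hxy]⟩
  · rintro u v ⟨p, q, hu⟩ ⟨p', q', hv⟩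
    obtain ⟨hu, hv⟩ := dependsOnVals_Icc_inf_sup hu hv
    exact ⟨p ⊓ p', q ⊔ q', fun x y hxy => by simp [hu x y hxy, hv x y hxy]⟩
  · rintro u v ⟨p, q, hu⟩ ⟨p', q', hv⟩
    obtain ⟨hu, hv⟩ := dependsOnVals_Icc_inf_sup hu hv
    exact ⟨p ⊓ p', q ⊔ q', fun x y hxy => by simp [hu x y hxy, hv x y hxy]⟩

/-! ### Evaluation, positivity and density in the free Banach lattice -/

namespace FBL

theorem posHom (f : FBL L) : PosHom (f : LStar L → ℝ) := Ambient.posHom f.1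

theorem abs_apply_le_norm (f : FBL L) (x : LStar L) : |f x| ≤ ‖f‖ :=
  Ambient.abs_apply_le_norm f.1 x

theorem norm_δ_le (a : L) : ‖δ a‖ ≤ 1 := by
  refine Ambient.norm_le_of (Ambient.eval a) ?_
  rintro s ⟨m, x, hx, rfl⟩
  exact hx a

@[simp] theorem abs_apply (f : FBL L) (x : LStar L) : |f| x = |f x| := rfl

/-- Evaluation at `x : L^*` as a continuous linear functional on `FBL⟨L⟩`. -/
noncomputable def evalCLM (x : LStar L) : FBL L →L[ℝ] ℝ :=
  LinearMap.mkContinuous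
    { toFun := fun f => f x
      map_add' := fun _ _ => rfl
      map_smul' := fun _ _ => rfl } 1
    fun f => (f.abs_apply_le_norm x).trans_eq (one_mul _).symm

@[simp] theorem evalCLM_apply (x : LStar L) (f : FBL L) : evalCLM x f = f x := rfl

theorem exists_pos_apply {f : FBL L} (hf : 0 < f) : ∃ x, 0 < f x := by
  by_contra! h
  exact hf.not_ge h

theorem pos_of_apply_pos {f : FBL L} (h0 : 0 ≤ f) {x : LStar L} (hx : 0 < f x) : 0 < f :=
  lt_of_le_not_ge h0 fun h => (h x).not_gt hx

/-- `FBL⟨L⟩` is the closure of the vector lattice generated by the `δ_a` in the ambient space;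
hence that vector lattice, viewed inside `FBL⟨L⟩`, is dense. -/
theorem exists_mem_FVL_norm_sub_lt (f : FBL L) {ε : ℝ} (hε : 0 < ε) :
    ∃ v ∈ FVL L, ‖v - f‖ < ε := by
  have lift : ∀ u ∈ vectorLat (Set.range (Ambient.eval (L := L))),
      ∃ v ∈ FVL L, (v.1 : Ambient L) = u := by
    intro u hu
    refine vectorLat_induction
      (P := fun u : Ambient L => ∃ v ∈ FVL L, (v.1 : Ambient L) = u) ?_ ?_ ?_ ?_ ?_ ?_ hu
    · rintro _ ⟨a, rfl⟩
      exact ⟨δ a, subset_vectorLat _ ⟨a, rfl⟩, rfl⟩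
    · exact ⟨0, zero_mem _, rfl⟩
    · rintro _ _ ⟨u, hu, rfl⟩ ⟨v, hv, rfl⟩
      exact ⟨u + v, add_mem hu hv, rfl⟩
    · rintro c _ ⟨u, hu, rfl⟩
      exact ⟨c • u, Submodule.smul_mem _ c hu, rfl⟩
    · rintro _ _ ⟨u, hu, rfl⟩ ⟨v, hv, rfl⟩
      exact ⟨u ⊔ v, supClosed_vectorLat _ hu hv, rfl⟩
    · rintro _ _ ⟨u, hu, rfl⟩ ⟨v, hv, rfl⟩
      exact ⟨u ⊓ v, infClosed_vectorLat _ hu hv, rfl⟩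
  have hcl : f.1 ∈ closure (vectorLat (Set.range (Ambient.eval (L := L))) : Set (Ambient L)) :=
    f.2
  obtain ⟨u, hu, hdist⟩ := Metric.mem_closure_iff.1 hcl ε hε
  obtain ⟨v, hv, rfl⟩ := lift u hu
  refine ⟨v, hv, ?_⟩
  rw [dist_comm, dist_eq_norm] at hdist
  exact hdist

end FBL

/-! ### Normalizing homomorphisms on an interval -/

namespace LStar

/-- The composition of `x : L^*` with a monotone map `φ : ℝ → [-1, 1]`. -/
def monoComp (φ : ℝ → Set.Icc (-1 : ℝ) 1) (hφ : Monotone φ) (x : LStar L) : LStar L where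
  toFun a := φ (x a)
  map_sup' a b := by
    rw [map_sup, ← hφ.map_sup]
    rfl
  map_inf' a b := by
    rw [map_inf, ← hφ.map_inf]
    rfl

@[simp] theorem monoComp_apply (φ : ℝ → Set.Icc (-1 : ℝ) 1) (hφ : Monotone φ) (x : LStar L)
    (a : L) : monoComp φ hφ x a = φ (x a) := rfl

/-- The multiple `r x` of `x : L^*`, for `r ∈ [0, 1]`. -/
def scale (r : ℝ) (h0 : 0 ≤ r) (h1 : r ≤ 1) (x : LStar L) : LStar L where
  toFun a := ⟨r * x a, by
    have := (x a).2
    constructor <;> nlinarith [this.1, this.2]⟩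
  map_sup' a b := Subtype.ext (by
    rw [map_sup]
    exact mul_max_of_nonneg _ _ h0)
  map_inf' a b := Subtype.ext (by
    rw [map_inf]
    exact mul_min_of_nonneg _ _ h0)

@[simp] theorem scale_apply (r : ℝ) (h0 : 0 ≤ r) (h1 : r ≤ 1) (x : LStar L) (a : L) :
    (scale r h0 h1 x a : ℝ) = r * x a := rfl

theorem abs_apply_le (x : LStar L) {a b e : L} (he : e ∈ Set.Icc a b) :
    |(x e : ℝ)| ≤ max |(x a : ℝ)| |(x b : ℝ)| := by
  have h1 : (x a : ℝ) ≤ x e := OrderHomClass.mono x he.1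
  have h2 : (x e : ℝ) ≤ x b := OrderHomClass.mono x he.2
  exact abs_le_max_abs_abs h1 h2

/-- Normalization on an interval: the restriction of `x` to `[a, b]` is a multiple of the
restriction of an element of `L^*`, with factor `|x a| ⊔ |x b|`. -/
theorem exists_eq_scale_on_Icc (x : LStar L) (a b : L) :
    ∃ y : LStar L, ∀ e ∈ Set.Icc a b,
      (x e : ℝ) = max |(x a : ℝ)| |(x b : ℝ)| * y e := by
  set M := max |(x a : ℝ)| |(x b : ℝ)|
  have hM0 : 0 ≤ M := le_max_of_le_left (abs_nonneg _)
  have h11 : (-1 : ℝ) ≤ 1 := by norm_num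
  -- Outside `[a, b]` the quotient `x e / M` may leave `[-1, 1]`, so it is truncated.
  have hφ : Monotone fun t : ℝ => Set.projIcc (-1) 1 h11 (t / M) := fun s t hst =>
    Set.monotone_projIcc (h := h11) (div_le_div_of_nonneg_right hst hM0)
  refine ⟨monoComp _ hφ x, fun e he => ?_⟩
  rw [monoComp_apply]
  have hle : |(x e : ℝ)| ≤ M := x.abs_apply_le he
  rcases hM0.eq_or_lt with hM | hM
  · rw [← hM] at hle ⊢
    simpa using hle
  · have hmem : (x e : ℝ) / M ∈ Set.Icc (-1 : ℝ) 1 := by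
      rw [Set.mem_Icc, ← abs_le, abs_div, abs_of_pos hM]
      exact (div_le_one hM).2 hle
    rw [Set.projIcc_of_mem h11 hmem]
    field_simp

end LStar

/-- A positively homogeneous function bounded by `ε` which depends only on values in `[a, b]` is
bounded by `ε (|δ_a| ⊔ |δ_b|)`. -/
theorem abs_le_mul_of_dependsOnVals_Icc {h : LStar L → ℝ} (hh : PosHom h) {a b : L}
    (hab : DependsOnVals h (Set.Icc a b)) {ε : ℝ} (hε : ∀ x, |h x| ≤ ε) (x : LStar L) :
    |h x| ≤ ε * max |(x a : ℝ)| |(x b : ℝ)| := by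
  obtain ⟨y, hy⟩ := x.exists_eq_scale_on_Icc a b
  have hM0 : 0 ≤ max |(x a : ℝ)| |(x b : ℝ)| := le_max_of_le_left (abs_nonneg _)
  have hM1 : max |(x a : ℝ)| |(x b : ℝ)| ≤ 1 := max_le (abs_le.2 (x a).2) (abs_le.2 (x b).2)
  rw [hab x (y.scale _ hM0 hM1) (fun e he => Subtype.ext (hy e he)),
    hh y _ _ hM0 (fun _ => rfl), abs_mul, abs_of_nonneg hM0, mul_comm]
  exact mul_le_mul_of_nonneg_right (hε y) hM0

/-! ### Order density over countably order bounded lattices -/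

theorem isOrderDense_FVL_of_countablyOrderBounded [Nonempty L] (hL : CountablyOrderBounded L) :
    IsOrderDense (FVL L) := by
  intro f hf
  choose v hv hvf using fun n : ℕ => f.exists_mem_FVL_norm_sub_lt (Nat.one_div_pos_of_nat (n := n))
  choose p q hpq using fun n => exists_dependsOnVals_Icc_of_mem_FVL (hv n)
  obtain ⟨a, b, hab⟩ := hL (Set.range p ∪ Set.range q)
    ((Set.countable_range p).union (Set.countable_range q))
  have hdv : ∀ n, DependsOnVals (v n) (Set.Icc a b) := fun n =>
    (hpq n).mono (Set.Icc_subset_Icc (hab _ (Or.inl (Set.mem_range_self n))).1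
      (hab _ (Or.inr (Set.mem_range_self n))).2)
  have hlim : ∀ x, Filter.Tendsto (fun n => v n x) Filter.atTop (nhds (f x)) := by
    intro x
    rw [tendsto_iff_dist_tendsto_zero]
    exact squeeze_zero (fun _ => dist_nonneg)
      (fun n => ((v n - f).abs_apply_le_norm x).trans (hvf n).le)
      tendsto_one_div_add_atTop_nhds_zero_nat
  have hdf : DependsOnVals f (Set.Icc a b) := by
    intro x y hxy
    refine tendsto_nhds_unique (hlim x) ?_
    simp only [hdv _ x y hxy]
    exact hlim y
  obtain ⟨x, hx⟩ := FBL.exists_pos_apply hf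
  obtain ⟨n, hn⟩ := exists_nat_one_div_lt (half_pos hx)
  set ε : ℝ := 1 / ((n : ℝ) + 1)
  have hε : 0 < ε := Nat.one_div_pos_of_nat
  have hclose : ∀ z, |v n z - f z| ≤ ε * max |(z a : ℝ)| |(z b : ℝ)| :=
    abs_le_mul_of_dependsOnVals_Icc (v n - f).posHom
      (fun z y hzy => by simp [hdv n z y hzy, hdf z y hzy])
      (fun z => ((v n - f).abs_apply_le_norm z).trans (hvf n).le)
  have hδ : ∀ e : L, |FBL.δ e| ∈ FVL L := fun e =>
    supClosed_vectorLat _ (subset_vectorLat _ (Set.mem_range_self e))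
      (neg_mem (subset_vectorLat _ (Set.mem_range_self e)))
  have hval : ∀ z, ((v n - ε • (|FBL.δ a| ⊔ |FBL.δ b|)) ⊔ 0 : FBL L) z =
      max (v n z - ε * max |(z a : ℝ)| |(z b : ℝ)|) 0 := fun z => by simp
  refine ⟨(v n - ε • (|FBL.δ a| ⊔ |FBL.δ b|)) ⊔ 0, ?_, ?_, ?_⟩
  · exact supClosed_vectorLat _
      (sub_mem (hv n) (Submodule.smul_mem _ _ (supClosed_vectorLat _ (hδ a) (hδ b))))
      (zero_mem _)
  · refine FBL.pos_of_apply_pos le_sup_right (x := x) ?_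
    rw [hval]
    have hM1 : max |(x a : ℝ)| |(x b : ℝ)| ≤ 1 :=
      max_le (abs_le.2 (x a).2) (abs_le.2 (x b).2)
    have h1 := (abs_le.1 (hclose x)).1
    have h2 : ε * max |(x a : ℝ)| |(x b : ℝ)| ≤ ε := mul_le_of_le_one_right hε.le hM1
    exact lt_max_of_lt_left (by linarith)
  · intro z
    change ((v n - ε • (|FBL.δ a| ⊔ |FBL.δ b|)) ⊔ 0 : FBL L) z ≤ f z
    rw [hval]
    refine max_le ?_ (hf.le z)
    linarith [(abs_le.1 (hclose z)).2]

/-! ### Chains with an unbounded countable subset -/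

/-- A monotone map from a chain to `[-1, 1]`, as an element of `L^*`. -/
def LStar.ofMonotone (tot : ∀ a b : L, a ≤ b ∨ b ≤ a) (φ : L → Set.Icc (-1 : ℝ) 1)
    (hφ : Monotone φ) : LStar L where
  toFun := φ
  map_sup' a b := by
    rcases tot a b with h | h
    · rw [sup_eq_right.2 h, sup_eq_right.2 (hφ h)]
    · rw [sup_eq_left.2 h, sup_eq_left.2 (hφ h)]
  map_inf' a b := by
    rcases tot a b with h | h
    · rw [inf_eq_left.2 h, inf_eq_left.2 (hφ h)]
    · rw [inf_eq_right.2 h, inf_eq_right.2 (hφ h)]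

/-- On a chain, the restriction of `x : L^*` to `[p, q]` extends to an element of `L^*` which has
modulus `1` off `[p, q]`. -/
theorem LStar.exists_eq_on_Icc_abs_eq_one (tot : ∀ a b : L, a ≤ b ∨ b ≤ a) (x : LStar L)
    (p q : L) : ∃ y : LStar L, (∀ e ∈ Set.Icc p q, y e = x e) ∧
      ∀ e ∉ Set.Icc p q, |(y e : ℝ)| = 1 := by
  classical
  let lo : Set.Icc (-1 : ℝ) 1 := ⟨-1, by norm_num⟩
  let hi : Set.Icc (-1 : ℝ) 1 := ⟨1, by norm_num⟩
  have hlo : ∀ t, lo ≤ t := fun t => t.2.1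
  have hhi : ∀ t, t ≤ hi := fun t => t.2.2
  let φ : L → Set.Icc (-1 : ℝ) 1 := fun e => if p ≤ e then if e ≤ q then x e else hi else lo
  have hφ : Monotone φ := by
    intro d e hde
    by_cases hd : p ≤ d
    · by_cases hq : e ≤ q
      · simpa [φ, hd, hd.trans hde, hq, hde.trans hq] using OrderHomClass.mono x hde
      · simpa [φ, hd.trans hde, hq] using hhi _
    · simpa [φ, hd] using hlo _
  refine ⟨LStar.ofMonotone tot φ hφ, fun e he => ?_, fun e he => ?_⟩
  · change φ e = x e
    simp [φ, he.1, he.2]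
  · change |(φ e : ℝ)| = 1
    by_cases hp : p ≤ e
    · have hq : ¬ e ≤ q := fun hq => he ⟨hp, hq⟩
      simp [φ, hp, hq, hi]
    · simp [φ, hp, lo]

theorem countablyOrderBounded_of_isOrderDense_FVL [Nonempty L]
    (tot : ∀ a b : L, a ≤ b ∨ b ≤ a) (hd : IsOrderDense (FVL L)) : CountablyOrderBounded L := by
  intro A hA
  obtain ⟨c⟩ := ‹Nonempty L›
  rcases A.eq_empty_or_nonempty with rfl | hne
  · exact ⟨c, c, by simp⟩
  by_contra! hunb
  obtain ⟨s, rfl⟩ := hA.exists_eq_range hne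
  -- The weights `2^{-k-2}` have sum `1 / 2`, less than the value `1` of `|δ_c|` at the constant `1`.
  let w : ℕ → ℝ := fun k => 1 / 2 / 2 / 2 ^ k
  have hw0 : ∀ k, 0 < w k := fun k => by positivity
  have hw : HasSum w (1 / 2) := hasSum_geometric_two' (1 / 2)
  have hsum : Summable fun k => w k • |FBL.δ (s k)| := by
    refine Summable.of_norm_bounded hw.summable fun k => ?_
    rw [norm_smul, norm_abs_eq_norm, Real.norm_of_nonneg (hw0 k).le]
    exact mul_le_of_le_one_right (hw0 k).le (FBL.norm_δ_le _)
  obtain ⟨F, hF⟩ := hsum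
  have hFx : ∀ x : LStar L, HasSum (fun k => w k * |(x (s k) : ℝ)|) (F x) := fun x => by
    simpa using (FBL.evalCLM x).hasSum hF
  have hval : ∀ x, ((|FBL.δ c| - F) ⊔ 0 : FBL L) x = max (|(x c : ℝ)| - F x) 0 :=
    fun x => by simp
  have hpos : 0 < ((|FBL.δ c| - F) ⊔ 0 : FBL L) := by
    let one : LStar L := LStar.ofMonotone tot (fun _ => ⟨1, by norm_num⟩) monotone_const
    have hone : ∀ e, (one e : ℝ) = 1 := fun _ => rfl
    refine FBL.pos_of_apply_pos le_sup_right (x := one) ?_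
    have h1 : F one = 1 / 2 := (hFx one).unique (by simpa [hone] using hw)
    rw [hval, h1, hone]
    norm_num
  obtain ⟨g, hg, hg0, hgf⟩ := hd _ hpos
  obtain ⟨p, q, hpq⟩ := exists_dependsOnVals_Icc_of_mem_FVL hg
  replace hpq := hpq.mono (Set.Icc_subset_Icc (inf_le_left (b := c)) (le_sup_left (b := c)))
  obtain ⟨x, hx⟩ := FBL.exists_pos_apply hg0
  obtain ⟨_, ⟨k, rfl⟩, hk⟩ := hunb (p ⊓ c) (q ⊔ c)
  have hout : s k ∉ Set.Icc (p ⊓ c) (q ⊔ c) := fun h => hk h.1 h.2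
  have hw1 : w k ≤ 1 := (le_hasSum hw k fun j _ => (hw0 j).le).trans (by norm_num)
  obtain ⟨y, hyin, hyout⟩ := (x.scale (w k) (hw0 k).le hw1).exists_eq_on_Icc_abs_eq_one tot
    (p ⊓ c) (q ⊔ c)
  have hgy : g y = w k * g x := by
    rw [hpq y _ hyin]
    exact g.posHom x _ _ (hw0 k).le fun _ => rfl
  have hFy : w k ≤ F y := by
    have := le_hasSum (hFx y) k fun j _ => mul_nonneg (hw0 j).le (abs_nonneg _)
    simpa [hyout _ hout] using this
  have hyc : |(y c : ℝ)| ≤ w k := by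
    rw [hyin c ⟨inf_le_right, le_sup_right⟩, LStar.scale_apply, abs_mul, abs_of_pos (hw0 k)]
    exact mul_le_of_le_one_right (hw0 k).le (abs_le.2 (x c).2)
  have hle : g y ≤ ((|FBL.δ c| - F) ⊔ 0 : FBL L) y := hgf y
  rw [hval, max_eq_right (by linarith), hgy] at hle
  exact hle.not_gt (mul_pos (hw0 k) hx)

theorem theorem4p6 (L : Type*) [DistribLattice L] [Nonempty L] :
    (CountablyOrderBounded L → IsOrderDense (FVL L)) ∧
    ((∀ a b : L, a ≤ b ∨ b ≤ a) → IsOrderDense (FVL L) → CountablyOrderBounded L) :=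
  ⟨isOrderDense_FVL_of_countablyOrderBounded, countablyOrderBounded_of_isOrderDense_FVL⟩
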